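/- Let $\Gamma$ be a finitely generated group with a finite symmetric generating set $\Sigma$. A generalized Schreier graph $S$ of $\Gamma$ is a countable union of Schreier graphs of $\Gamma$, that is, the $\Sigma$-edge-labeled graph of an action of $\Gamma$ on a countable set $V(S)$ (the edge with label $\sigma\in\Sigma$ at $v$ leads to $\sigma v$). For a finite set $Q$ and $r\ge 1$ let $U^{r,Q}_{\Gamma,\Sigma}$ be the set of isomorphism classes of rooted, $\Sigma$-edge-labeled, $Q$-vertex-labeled balls of radius $r$ that occur in $Q$-labeled Schreier graphs of $\Gamma$. For an action of $\Gamma$ on a set $V$ and a map $\phi:V\to Q$ let $\mathrm{Conf}_{r,V}(\phi)\subseteq U^{r,Q}_{\Gamma,\Sigma}$ be the set of the classes of the $Q$-labeled $r$-balls around the points of $V$. A sequence $(S_n)_{n\ge1}$ of generalized Schreier graphs is qualitatively convergent if for all finite $Q$, all $r\ge1$ and all $\mathcal A\subseteq U^{r,Q}_{\Gamma,\Sigma}$, either for all large $n$ there is $\phi_n:V(S_n)\to Q$ with $\mathrm{Conf}_{r,S_n}(\phi_n)=\mathcal A$, or for all large $n$ there is no such $\phi_n$. A continuous action of $\Gamma$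 on a topological space $X$ is stable if whenever $\gamma x=x$, the element $\gamma$ fixes every point of some neighbourhood of $x$. Theorem. Let $(S_n)_{n\ge1}$ be a qualitatively convergent sequence of generalized Schreier graphs of $\Gamma$. Then there exist a totally disconnected compact metric space $X$ and a stable action $\beta:\Gamma\curvearrowright X$ such that $(S_n)$ converges qualitatively to $\beta$: for every finite set $Q$, every $r\ge1$ and every $\mathcal A\subseteq U^{r,Q}_{\Gamma,\Sigma}$, there is a continuous map $\psi:X\to Q$ with $\mathrm{Conf}_{r,X}(\psi)=\mathcal A$ if and only if for all large enough $n$ there is a map $\phi_n:V(S_n)\to Q$ with $\mathrm{Conf}_{r,S_n}(\phi_n)=\mathcal A$. Moreover, unless the numbers $|V(S_n)|$ are bounded by a constant for all large $n$, the space $X$ can be chosen to have the cardinality of the continuum. -/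

import Mathlib

open Filter Topology

universe u

/-- A rooted directed graph with edges labelled by `L` and vertices labelled by `Q`. -/
structure RootedLabeledGraph (L Q : Type*) where
  /-- the vertices -/
  Vert : Type u
  /-- `edge l a b`: there is a directed edge from `a` to `b` labelled by `l` -/
  edge : L → Vert → Vert → Prop
  /-- the labels of the vertices -/
  label : Vert → Q
  /-- the root -/
  root : Vert

namespace RootedLabeledGraph

/-- Rooted, edge-labelled and vertex-labelled isomorphism. -/
def Iso {L Q : Type*} (G H : RootedLabeledGraph.{u} L Q) : Prop :=
  ∃ e : G.Vert ≃ H.Vert, e G.root = H.root ∧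
    (∀ l a b, G.edge l a b ↔ H.edge l (e a) (e b)) ∧ ∀ a, H.label (e a) = G.label a

/-- Isomorphism is an equivalence relation. -/
def isoSetoid (L Q : Type*) : Setoid (RootedLabeledGraph.{u} L Q) where
  r := Iso
  iseqv :=
    { refl := fun G => ⟨Equiv.refl _, rfl, fun _ _ _ => Iff.rfl, fun _ => rfl⟩
      symm := by
        rintro G H ⟨e, h1, h2, h3⟩
        refine ⟨e.symm, by simp [← h1], fun l a b => ?_, fun a => ?_⟩
        · rw [h2]; simp
        · rw [← h3]; simp
      trans := by
        rintro G H K ⟨e, h1, h2, h3⟩ ⟨f, k1, k2, k3⟩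
        refine ⟨e.trans f, by simp [h1, k1], fun l a b => ?_, fun a => ?_⟩
        · rw [h2, k2]; rfl
        · simp [h3, k3] }

end RootedLabeledGraph

section SchreierBalls

variable {Γ : Type u} [Group Γ] (S : Finset Γ)

/-- The vertices at distance at most `r` from `x` in the Schreier graph of the action of `Γ` on
`V` with respect to `S`, that is, the endpoints of the `S`-walks of length at most `r` that start
at `x`. (The set `S` will always be symmetric.) -/
def schreierBall {V : Type u} [MulAction Γ V] (r : ℕ) (x : V) : Set V :=
  {y | ∃ w : List Γ, w.length ≤ r ∧ (∀ σ ∈ w, σ ∈ S) ∧ w.prod • x = y}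

/-- The ball of radius `r` around `x` in the Schreier graph of the action of `Γ` on `V`, as a
rooted, `S`-edge-labelled, `Q`-vertex-labelled graph: it is the subgraph induced on the vertices
at distance at most `r` from `x`, the edge labelled by `σ ∈ S` at `a` leads to `σ • a`, and the
vertices are labelled by `φ`. -/
def labeledBall {V : Type u} [MulAction Γ V] {Q : Type} (r : ℕ) (φ : V → Q) (x : V) :
    RootedLabeledGraph.{u} {σ : Γ // σ ∈ S} Q where
  Vert := schreierBall S r x
  edge σ a b := (σ : Γ) • (a : V) = b
  label a := φ a
  root := ⟨x, [], by simp, by simp, by simp⟩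

/-- The set of isomorphism classes of rooted, `S`-edge-labelled, `Q`-vertex-labelled balls of
radius `r` that occur in some `Q`-labelled Schreier graph of `Γ`. Here the Schreier graph of a
subgroup `H` lives on the cosets of `H`, and its root is the coset `H`. -/
def BallClass (r : ℕ) (Q : Type) : Type (u + 1) :=
  {c : Quotient (RootedLabeledGraph.isoSetoid.{u} {σ : Γ // σ ∈ S} Q) //
    ∃ (H : Subgroup Γ) (φ : Γ ⧸ H → Q),
      c = Quotient.mk _ (labeledBall S r φ ((1 : Γ) : Γ ⧸ H))}

/-- The `r`-configuration of a labelling `φ : V → Q`: the set of all labelled balls of radius `r`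
that occur in the labelled graph `(V, φ)`. It is used both for generalized Schreier graphs and
for actions on topological spaces. -/
def Conf {V : Type u} [MulAction Γ V] {Q : Type} (r : ℕ) (φ : V → Q) :
    Set (BallClass S r Q) :=
  {c | ∃ x : V, c.1 = Quotient.mk _ (labeledBall S r φ x)}

end SchreierBalls

/-- A generalized Schreier graph of `Γ`: a countable union of Schreier graphs of `Γ`, that is, the
graph of a (not necessarily transitive) action of `Γ` on a countable set. -/
structure GeneralizedSchreierGraph (Γ : Type u) [Group Γ] where
  /-- the vertices -/
  Vert : Type u
  /-- the action of the group on the vertices -/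
  [action : MulAction Γ Vert]
  /-- there are countably many vertices -/
  [countable : Countable Vert]

attribute [instance] GeneralizedSchreierGraph.action GeneralizedSchreierGraph.countable

/-- The action of the (discrete) group `Γ` on `X` is stable: it is continuous, and if `γ` fixes
`x`, then `γ` fixes every point of some neighbourhood of `x`. -/
structure IsStableAction (Γ : Type u) [Group Γ] (X : Type u) [TopologicalSpace X]
    [MulAction Γ X] : Prop where
  continuous_smul : ∀ γ : Γ, Continuous fun x : X => γ • x
  eventually_fixed : ∀ (γ : Γ) (x : X), γ • x = x → ∀ᶠ y in 𝓝 x, γ • y = y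

/-- Qualitative convergence of a sequence of generalized Schreier graphs: for every finite set `Q`,
every `r ≥ 1` and every set `A` of labelled balls of radius `r`, either `A` is a configuration of
`G n` for all large `n`, or `A` is not a configuration of `G n` for all large `n`. -/
def QualitativelyConvergent {Γ : Type u} [Group Γ] (S : Finset Γ)
    (G : ℕ → GeneralizedSchreierGraph Γ) : Prop :=
  ∀ (Q : Type) [Finite Q] (r : ℕ), 1 ≤ r → ∀ A : Set (BallClass S r Q),
    (∀ᶠ n in atTop, ∃ φ : (G n).Vert → Q, Conf S r φ = A) ∨
      (∀ᶠ n in atTop, ¬ ∃ φ : (G n).Vert → Q, Conf S r φ = A)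

/-- The sequence `G` converges qualitatively to the action of `Γ` on `X`: a set of labelled balls is
the configuration of a continuous labelling of `X` by a finite (discrete) set if and only if it is
a configuration of `G n` for all large `n`. -/
def QualitativelyConvergesTo {Γ : Type u} [Group Γ] (S : Finset Γ)
    (G : ℕ → GeneralizedSchreierGraph Γ) (X : Type u) [TopologicalSpace X]
    [MulAction Γ X] : Prop :=
  ∀ (Q : Type) [Finite Q] [TopologicalSpace Q] [DiscreteTopology Q] (r : ℕ), 1 ≤ r →
    ∀ A : Set (BallClass S r Q),
      (∃ ψ : X → Q, Continuous ψ ∧ Conf S r ψ = A) ↔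
        ∀ᶠ n in atTop, ∃ φ : (G n).Vert → Q, Conf S r φ = A

/-!
Along an ultrafilter the alternative in the definition of convergence disappears, so it suffices to
attach to any ultrafilter on the index set a limit action whose configurations are those of almost
all members of the family. Label the points of every member by a countable amount of data (a point
of a fixed Cantor space `L`), map each member equivariantly to the shift `Γ → L`, and let `X` be
the set of limits of these images.

Continuous labellings of `X` extend to the shift, hence pull back to the members, and a finite
amount of information about a ball can be transported in this way; the only thing which can go wrong
in the limit is that a point acquires new stabilizers. This is prevented by putting into the label
of a point, for each `γ`, a colour that is `0` if `γ` fixes the point and otherwise differs from the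
colour of its image. Conversely a configuration of almost all members is realized on `X` because
one labelling for each realizable pattern set is built into `L`; up to relabelling there are only
countably many pattern sets. A last factor of `L` maps `X` onto the Cantor space as soon as the
members become large.
-/

section SchreierBallLemmas

variable {Γ : Type u} [Group Γ] {S : Finset Γ} {V : Type u} [MulAction Γ V] {r s : ℕ} {x y : V}

theorem self_mem_schreierBall : x ∈ schreierBall S r x :=
  ⟨[], by simp⟩

theorem schreierBall_mono (h : r ≤ s) : schreierBall S r x ⊆ schreierBall S s x :=
  fun _ ⟨w, hw, hwy⟩ => ⟨w, hw.trans h, hwy⟩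

theorem smul_mem_schreierBall {σ : Γ} (hσ : σ ∈ S) (hy : y ∈ schreierBall S r x) :
    σ • y ∈ schreierBall S (r + 1) x := by
  obtain ⟨w, hw, hwS, rfl⟩ := hy
  exact ⟨σ :: w, by simpa using hw, by simpa using ⟨hσ, hwS⟩, by simp [mul_smul]⟩

theorem schreierBall_finite (S : Finset Γ) (r : ℕ) (x : V) : (schreierBall S r x).Finite := by
  refine ((List.finite_length_le S r).image fun w => (w.map Subtype.val).prod • x).subset ?_
  rintro _ ⟨w, hw, hwS, rfl⟩
  lift w to List S using hwS
  exact ⟨w, by simpa using hw, rfl⟩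

variable (S) in
/-- The ball of radius `r` around the identity in the Cayley graph of `Γ`, that is, the set of the
products of at most `r` elements of `S`. -/
abbrev cayleyBall (r : ℕ) : Set Γ := schreierBall S r (1 : Γ)

instance (r : ℕ) : Finite (cayleyBall S r) := schreierBall_finite S r 1

theorem mem_schreierBall_iff : y ∈ schreierBall S r x ↔ ∃ γ ∈ cayleyBall S r, γ • x = y := by
  constructor
  · rintro ⟨w, hw, hwS, rfl⟩
    exact ⟨w.prod, ⟨w, hw, hwS, mul_one _⟩, rfl⟩
  · rintro ⟨_, ⟨w, hw, hwS, rfl⟩, rfl⟩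
    exact ⟨w, hw, hwS, by simp⟩

variable (S r x) in
/-- The orbit map at `x`, as a parametrization of the Schreier ball around `x` by the ball of the
same radius in the Cayley graph. -/
def toSchreierBall (γ : cayleyBall S r) : schreierBall S r x :=
  ⟨(γ : Γ) • x, mem_schreierBall_iff.2 ⟨γ, γ.2, rfl⟩⟩

theorem toSchreierBall_surjective : Function.Surjective (toSchreierBall S r x) := by
  rintro ⟨_, hy⟩
  obtain ⟨γ, hγ, rfl⟩ := mem_schreierBall_iff.1 hy
  exact ⟨⟨γ, hγ⟩, rfl⟩

end SchreierBallLemmas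

theorem exists_equiv_apply_eq_of_surjective {α β δ : Type*} {f : α → β} {g : α → δ}
    (hf : Function.Surjective f) (hg : Function.Surjective g)
    (h : ∀ a b, f a = f b ↔ g a = g b) : ∃ e : β ≃ δ, ∀ a, e (f a) = g a := by
  let e : β ≃ δ := (Setoid.quotientKerEquivOfSurjective f hf).symm.trans
    ((Quotient.congrRight h).trans (Setoid.quotientKerEquivOfSurjective g hg))
  refine ⟨e, fun a => ?_⟩
  have : (Setoid.quotientKerEquivOfSurjective f hf).symm (f a) = Quotient.mk _ a :=
    (Equiv.symm_apply_eq _).2 rfl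
  simp only [e, Equiv.trans_apply, this]
  rfl

section LocalPatterns

variable {Γ : Type u} [Group Γ] (S : Finset Γ)

/-- Group-theoretic data that determine a labelled ball of radius `r`: which pairs of elements of
the Cayley ball of radius `r + 1` agree at the root, and the labels of the points to which these
elements move the root. The additional unit of radius records the edges between vertices at
distance `r` from the root. -/
abbrev LocalPattern (r : ℕ) (Q : Type) : Type u :=
  Set (cayleyBall S (r + 1) × cayleyBall S (r + 1)) × (cayleyBall S (r + 1) → Q)

/-- The local pattern of the labelling `φ` at the point `x`. -/
def localPattern {V : Type*} [MulAction Γ V] {Q : Type} (r : ℕ) (φ : V → Q) (x : V) :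
    LocalPattern S r Q :=
  ({p | (p.1 : Γ) • x = (p.2 : Γ) • x}, fun γ => φ ((γ : Γ) • x))

variable {S} {Q : Type} {r : ℕ}

theorem smul_eq_smul_iff_of_localPattern_eq {V W : Type*} [MulAction Γ V] [MulAction Γ W]
    {φ : V → Q} {φ' : W → Q} {x : V} {y : W} (h : localPattern S r φ x = localPattern S r φ' y)
    {a b : Γ} (ha : a ∈ cayleyBall S (r + 1)) (hb : b ∈ cayleyBall S (r + 1)) :
    a • x = b • x ↔ a • y = b • y :=
  Set.ext_iff.1 (congrArg Prod.fst h) (⟨a, ha⟩, ⟨b, hb⟩)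

theorem apply_smul_eq_of_localPattern_eq {V W : Type*} [MulAction Γ V] [MulAction Γ W]
    {φ : V → Q} {φ' : W → Q} {x : V} {y : W} (h : localPattern S r φ x = localPattern S r φ' y)
    {a : Γ} (ha : a ∈ cayleyBall S (r + 1)) : φ (a • x) = φ' (a • y) :=
  congrFun (congrArg Prod.snd h) ⟨a, ha⟩

theorem range_localPattern_comp {V : Type*} [MulAction Γ V] {R : Type} (φ : V → Q) (e : Q → R) :
    Set.range (localPattern S r (e ∘ φ)) =
      Prod.map id (e ∘ ·) '' Set.range (localPattern S r φ) :=
  Set.range_comp (Prod.map id (e ∘ ·)) (localPattern S r φ)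

variable {V W : Type u} [MulAction Γ V] [MulAction Γ W] {φ : V → Q} {φ' : W → Q}

theorem labeledBall_iso_of_localPattern_eq {x : V} {y : W}
    (h : localPattern S r φ x = localPattern S r φ' y) :
    (labeledBall S r φ x).Iso (labeledBall S r φ' y) := by
  have hmono : cayleyBall S r ⊆ cayleyBall S (r + 1) := schreierBall_mono r.le_succ
  obtain ⟨e, he⟩ := exists_equiv_apply_eq_of_surjective
    (toSchreierBall_surjective (S := S) (r := r) (x := x))
    (toSchreierBall_surjective (S := S) (r := r) (x := y)) fun a b => by
      simpa only [toSchreierBall, Subtype.mk.injEq] using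
        smul_eq_smul_iff_of_localPattern_eq h (hmono a.2) (hmono b.2)
  have hroot : e ⟨x, self_mem_schreierBall⟩ = ⟨y, self_mem_schreierBall⟩ := by
    simpa only [toSchreierBall, one_smul] using he ⟨1, self_mem_schreierBall⟩
  have hedge (σ : {σ // σ ∈ S}) (a b : schreierBall S r x) :
      (σ : Γ) • (a : V) = b ↔ (σ : Γ) • (e a : W) = e b := by
    obtain ⟨a, rfl⟩ := toSchreierBall_surjective a
    obtain ⟨b, rfl⟩ := toSchreierBall_surjective b
    rw [he, he]
    simpa only [toSchreierBall, mul_smul, smul_eq_mul] using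
      smul_eq_smul_iff_of_localPattern_eq h (smul_mem_schreierBall σ.2 a.2) (hmono b.2)
  have hlabel (a : schreierBall S r x) : φ' (e a) = φ a := by
    obtain ⟨a, rfl⟩ := toSchreierBall_surjective a
    rw [he]
    exact (apply_smul_eq_of_localPattern_eq h (hmono a.2)).symm
  exact ⟨e, hroot, hedge, hlabel⟩

theorem conf_subset_of_range_localPattern_subset
    (h : Set.range (localPattern S r φ) ⊆ Set.range (localPattern S r φ')) :
    Conf S r φ ⊆ Conf S r φ' := by
  rintro c ⟨x, hx⟩
  obtain ⟨y, hy⟩ := h ⟨x, rfl⟩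
  exact ⟨y, hx.trans (Quotient.sound (labeledBall_iso_of_localPattern_eq hy.symm))⟩

theorem conf_eq_of_range_localPattern_eq
    (h : Set.range (localPattern S r φ) = Set.range (localPattern S r φ')) :
    Conf S r φ = Conf S r φ' :=
  (conf_subset_of_range_localPattern_subset h.le).antisymm
    (conf_subset_of_range_localPattern_subset h.ge)

theorem conf_comp_eq_of_range_localPattern_eq {R : Type} (e : Q → R)
    (h : Set.range (localPattern S r φ) = Set.range (localPattern S r φ')) :
    Conf S r (e ∘ φ) = Conf S r (e ∘ φ') :=
  conf_eq_of_range_localPattern_eq (by simp only [range_localPattern_comp, h])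

theorem exists_conf_eq_iff_of_isEmpty [IsEmpty Q] {A : Set (BallClass S r Q)} :
    (∃ φ : V → Q, Conf S r φ = A) ↔ IsEmpty V ∧ A = ∅ := by
  have hconf (h : IsEmpty V) (φ : V → Q) : Conf S r φ = ∅ :=
    Set.eq_empty_of_forall_notMem fun _ ⟨x, _⟩ => h.false x
  constructor
  · rintro ⟨φ, rfl⟩
    have hV : IsEmpty V := Function.isEmpty φ
    exact ⟨hV, hconf hV φ⟩
  · rintro ⟨hV, rfl⟩
    exact ⟨isEmptyElim, hconf hV _⟩

end LocalPatterns

section FixedPointColorings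

/-- A colouring with the colours `0, 1, 2, 3` that recognizes the fixed points of `f`: they have the
colour `0`, and every other point has a nonzero colour that differs from the colour of its
image. In this form the condition passes to limits. -/
def IsFixedPointColoring {V : Type*} (f : V → V) (c : V → Fin 4) : Prop :=
  ∀ v, f v = v ∧ c v = 0 ∨ c (f v) ≠ c v ∧ c v ≠ 0

theorem IsFixedPointColoring.apply_eq_iff {V : Type*} {f : V → V} {c : V → Fin 4}
    (h : IsFixedPointColoring f c) (v : V) : f v = v ↔ c v = 0 := by
  rcases h v with ⟨hf, hc⟩ | ⟨hf, hc⟩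
  · exact iff_of_true hf hc
  · exact iff_of_false (fun hv => hf (congrArg c hv)) hc

theorem exists_fin_three_coloring_of_wellFounded {V : Type*} {lt : V → V → Prop}
    (hlt : WellFounded lt) (p q : V → V) :
    ∃ c : V → Fin 3, ∀ v, (lt (p v) v → c v ≠ c (p v)) ∧ (lt (q v) v → c v ≠ c (q v)) := by
  classical
  have avoid : ∀ a b : Fin 3, ∃ d, d ≠ a ∧ d ≠ b := by decide
  choose pick pick_ne_left pick_ne_right using avoid
  let step (v : V) (rec : ∀ w, lt w v → Fin 3) : Fin 3 :=
    pick (if h : lt (p v) v then rec _ h else 0) (if h : lt (q v) v then rec _ h else 0)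
  refine ⟨hlt.fix step, fun v => ⟨fun hp => ?_, fun hq => ?_⟩⟩
  · rw [hlt.fix_eq]
    simp only [step, hp, dif_pos]
    exact pick_ne_left _ _
  · rw [hlt.fix_eq]
    simp only [step, hq, dif_pos]
    exact pick_ne_right _ _

theorem exists_isFixedPointColoring {V : Type*} (f : Equiv.Perm V) :
    ∃ c : V → Fin 4, IsFixedPointColoring f c := by
  classical
  obtain ⟨c, hc⟩ := exists_fin_three_coloring_of_wellFounded
    (IsWellFounded.wf (r := (WellOrderingRel : V → V → Prop))) f f.symm
  have hne {v : V} (hv : f v ≠ v) : c (f v) ≠ c v := by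
    rcases trichotomous_of WellOrderingRel (f v) v with h | h | h
    · exact ((hc v).1 h).symm
    · exact absurd h hv
    · simpa using (hc (f v)).2 (by simpa using h)
  refine ⟨fun v => if f v = v then 0 else (c v).succ, fun v => ?_⟩
  by_cases hv : f v = v
  · simp [hv]
  · have hfv : f (f v) ≠ f v := fun h => hv (f.injective h)
    simp [hv, hfv, hne hv]

theorem isClosed_setOf_isFixedPointColoring {K : Type*} [TopologicalSpace K] [T2Space K]
    {g : K → K} (hg : Continuous g) {c : K → Fin 4} (hc : Continuous c) :
    IsClosed {x | g x = x ∧ c x = 0 ∨ c (g x) ≠ c x ∧ c x ≠ 0} := by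
  have hclosed (P : Fin 4 × Fin 4 → Prop) : IsClosed {x | P (c (g x), c x)} :=
    (isClosed_discrete {p | P p}).preimage ((hc.comp hg).prodMk hc)
  exact ((isClosed_eq hg continuous_id).inter (hclosed fun p => p.2 = 0)).union
    (hclosed fun p => p.1 ≠ p.2 ∧ p.2 ≠ 0)

theorem isStableAction_of_isFixedPointColoring {Γ X : Type u} [Group Γ] [TopologicalSpace X]
    [MulAction Γ X] [ContinuousConstSMul Γ X] {c : Γ → X → Fin 4} (hc : ∀ γ, Continuous (c γ))
    (hcol : ∀ γ : Γ, IsFixedPointColoring (fun x : X => γ • x) (c γ)) : IsStableAction Γ X where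
  continuous_smul := continuous_const_smul
  eventually_fixed γ x hx := by
    simp only [(hcol γ).apply_eq_iff] at hx ⊢
    exact (hc γ).continuousAt.eventually_mem ((isOpen_discrete {0}).mem_nhds hx)

variable {Γ : Type u} [Group Γ] (S : Finset Γ) {K : Type*} [MulAction Γ K] {Q : Type}

/-- The local pattern of `f` at `z`, except that coincidences of translates of `z` are read off from
the colourings `c`. Unlike the local pattern it depends continuously on `z`. -/
def coloredPattern (r : ℕ) (c : Γ → K → Fin 4) (f : K → Q) (z : K) : LocalPattern S r Q :=
  ({p | c ((p.2 : Γ)⁻¹ * p.1) z = 0}, fun γ => f ((γ : Γ) • z))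

theorem localPattern_comp_eq_coloredPattern_comp {W : Type*} [MulAction Γ W] {c : Γ → K → Fin 4}
    (j : W →[Γ] K) (hc : ∀ γ : Γ, IsFixedPointColoring (fun w : W => γ • w) (c γ ∘ j)) (r : ℕ)
    (f : K → Q) : localPattern S r (f ∘ j) = coloredPattern S r c f ∘ j := by
  funext w
  refine Prod.ext (Set.ext fun p => ?_) (funext fun γ => congrArg f (map_smul j _ w))
  change (p.1 : Γ) • w = (p.2 : Γ) • w ↔ (c ((p.2 : Γ)⁻¹ * p.1) ∘ j) w = 0
  rw [← (hc _).apply_eq_iff, mul_smul, inv_smul_eq_iff]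

theorem isLocallyConstant_coloredPattern [TopologicalSpace K] [ContinuousConstSMul Γ K]
    [TopologicalSpace Q] [DiscreteTopology Q] (r : ℕ) {c : Γ → K → Fin 4}
    (hc : ∀ γ, Continuous (c γ)) {f : K → Q} (hf : Continuous f) :
    IsLocallyConstant (coloredPattern S r c f) := by
  let B := cayleyBall S (r + 1)
  have hdata : IsLocallyConstant fun z =>
      ((fun p : B × B => c ((p.2 : Γ)⁻¹ * p.1) z), fun γ : B => f ((γ : Γ) • z)) :=
    (IsLocallyConstant.iff_continuous _).2 (by fun_prop)
  exact hdata.comp fun d : (B × B → Fin 4) × (B → Q) => ({p | d.1 p = 0}, d.2)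

end FixedPointColorings

section LimitSets

variable {I : Type*} {V : I → Type*} {K : Type*} [TopologicalSpace K]

/-- The set of limits along `ω` of points in the images of the maps `π i`. -/
def limitSet (ω : Filter I) (π : ∀ i, V i → K) : Set K :=
  {x | MapClusterPt x (comap Sigma.fst ω) fun p : Σ i, V i => π p.1 p.2}

theorem mem_limitSet_iff {ω : Filter I} {π : ∀ i, V i → K} {x : K} :
    x ∈ limitSet ω π ↔ ∀ U ∈ 𝓝 x, ∃ᶠ i in ω, ∃ v, π i v ∈ U := by
  simp [limitSet, mapClusterPt_iff_frequently, frequently_comap, Sigma.exists]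

theorem isClosed_limitSet {ω : Filter I} {π : ∀ i, V i → K} : IsClosed (limitSet ω π) :=
  isClosed_setOfPred_clusterPt

theorem limitSet_subset_of_isClosed {ω : Filter I} {π : ∀ i, V i → K} {C : Set K}
    (hC : IsClosed C) (h : ∀ i v, π i v ∈ C) : limitSet ω π ⊆ C :=
  fun _ hx => hC.mem_of_mapClusterPt hx (.of_forall fun p => h p.1 p.2)

theorem image_limitSet [CompactSpace K] {Y : Type*} [TopologicalSpace Y] [T2Space Y] (ω : Filter I)
    (π : ∀ i, V i → K) {g : K → Y} (hg : Continuous g) :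
    g '' limitSet ω π = limitSet ω fun i => g ∘ π i := by
  refine Set.Subset.antisymm
    (Set.image_subset_iff.2 fun x hx => hx.continuousAt_comp hg.continuousAt) fun y hy => ?_
  obtain ⟨U, hU, hUy⟩ := mapClusterPt_iff_ultrafilter.1 hy
  obtain ⟨x, hx⟩ : ∃ x, Tendsto (fun p : Σ i, V i => π p.1 p.2) U (𝓝 x) :=
    ⟨_, (U.map fun p : Σ i, V i => π p.1 p.2).le_nhds_lim⟩
  exact ⟨x, mapClusterPt_iff_ultrafilter.2 ⟨U, hU, hx⟩,
    tendsto_nhds_unique ((hg.tendsto x).comp hx) hUy⟩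

theorem eventually_range_eq_limitSet {P : Type*} [TopologicalSpace P] [DiscreteTopology P]
    [Finite P] (ω : Ultrafilter I) (ρ : ∀ i, V i → P) :
    ∀ᶠ i in (ω : Filter I), Set.range (ρ i) = limitSet ω ρ := by
  simp only [Set.ext_iff]
  refine eventually_all.2 fun q => ?_
  have hq : q ∈ limitSet ω ρ ↔ ∀ᶠ i in (ω : Filter I), q ∈ Set.range (ρ i) := by
    rw [mem_limitSet_iff, nhds_discrete, ← Ultrafilter.frequently_iff_eventually]
    exact ⟨fun h => h {q} rfl, fun h U hU => h.mono fun i ⟨v, hv⟩ => ⟨v, hv ▸ hU⟩⟩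
  by_cases h : q ∈ limitSet ω ρ
  · exact (hq.1 h).mono fun i hi => iff_of_true hi h
  · exact (Ultrafilter.eventually_not.2 (hq.not.1 h)).mono fun i hi => iff_of_false hi h

theorem eventually_range_comp_eq_image_limitSet [CompactSpace K] {P : Type*} [Finite P]
    (ω : Ultrafilter I) (π : ∀ i, V i → K) {p : K → P} (hp : IsLocallyConstant p) :
    ∀ᶠ i in (ω : Filter I), Set.range (p ∘ π i) = p '' limitSet ω π := by
  let _ : TopologicalSpace P := ⊥
  have : DiscreteTopology P := ⟨rfl⟩
  rw [image_limitSet _ _ hp.continuous]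
  exact eventually_range_eq_limitSet ω fun i => p ∘ π i

theorem eventually_isEmpty_iff_limitSet_eq_empty [CompactSpace K] (ω : Ultrafilter I)
    (π : ∀ i, V i → K) : ∀ᶠ i in (ω : Filter I), IsEmpty (V i) ↔ limitSet ω π = ∅ := by
  filter_upwards [eventually_range_comp_eq_image_limitSet ω π (.const ())] with i hi
  rw [← Set.range_eq_empty_iff, hi, Set.image_eq_empty]

end LimitSets

section LimitActions

variable {Γ : Type u} [Group Γ] {I : Type*} {V : I → Type u} [∀ i, MulAction Γ (V i)]
  {K : Type u} [TopologicalSpace K] [MulAction Γ K] [ContinuousConstSMul Γ K]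

/-- The limit set of equivariant maps `π i : V i → K` along `ω`, with the action of `Γ` inherited
from `K`. -/
def limitAction (ω : Filter I) (π : ∀ i, V i →[Γ] K) : SubMulAction Γ K where
  carrier := limitSet ω fun i => π i
  smul_mem' γ x hx := mem_limitSet_iff.2 fun U hU =>
    (mem_limitSet_iff.1 hx _ ((continuous_const_smul γ).continuousAt hU)).mono
      fun _ ⟨v, hv⟩ => ⟨γ • v, by rw [map_smul]; exact hv⟩

theorem coe_limitAction (ω : Filter I) (π : ∀ i, V i →[Γ] K) :
    (limitAction ω π : Set K) = limitSet ω fun i => π i :=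
  rfl

/-- The maps `π i` carry the continuous functions `c γ` on `K` to colourings that recognize the
fixed points of the group elements. -/
structure DetectsFixedPoints (π : ∀ i, V i →[Γ] K) (c : Γ → K → Fin 4) : Prop where
  continuous : ∀ γ, Continuous (c γ)
  isFixedPointColoring : ∀ (γ : Γ) i, IsFixedPointColoring (fun v : V i => γ • v) (c γ ∘ π i)

/-- For every set `T` of local patterns, one continuous labelling of `K` pulls back to a labelling
with the set of patterns `T` on every `V i` that has such a labelling. -/
def RealizesPatterns (S : Finset Γ) (π : ∀ i, V i →[Γ] K) : Prop :=
  ∀ (r k : ℕ) (T : Set (LocalPattern S r (Fin (k + 1)))), ∃ f : K → Fin (k + 1), Continuous f ∧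
    ∀ i, (∃ φ : V i → Fin (k + 1), Set.range (localPattern S r φ) = T) →
      Set.range (localPattern S r (f ∘ π i)) = T

variable {S : Finset Γ} {ω : Ultrafilter I} {π : ∀ i, V i →[Γ] K} {c : Γ → K → Fin 4} {Q : Type}

instance [CompactSpace K] : CompactSpace (limitAction (ω : Filter I) π) := by
  have hcompact : IsCompact (limitAction (ω : Filter I) π : Set K) :=
    coe_limitAction ω π ▸ isClosed_limitSet.isCompact
  exact isCompact_iff_compactSpace.1 hcompact

instance [SecondCountableTopology K] :
    SecondCountableTopology (limitAction (ω : Filter I) π) :=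
  IsEmbedding.subtypeVal.secondCountableTopology

instance : ContinuousConstSMul Γ (limitAction (ω : Filter I) π) where
  continuous_const_smul γ := (continuous_subtype_val.const_smul γ).subtype_mk _

namespace DetectsFixedPoints

theorem isFixedPointColoring_limitAction [T2Space K] (h : DetectsFixedPoints π c) (γ : Γ) :
    IsFixedPointColoring (fun x : limitAction (ω : Filter I) π => γ • x)
      (c γ ∘ Subtype.val) := by
  have hpoint (i : I) (v : V i) :
      γ • π i v = π i v ∧ c γ (π i v) = 0 ∨
        c γ (γ • π i v) ≠ c γ (π i v) ∧ c γ (π i v) ≠ 0 := by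
    rw [← map_smul]
    exact (h.isFixedPointColoring γ i v).imp_left (And.imp_left (congrArg (π i)))
  have hlimit := limitSet_subset_of_isClosed (ω := (ω : Filter I))
    (isClosed_setOf_isFixedPointColoring (continuous_const_smul γ) (h.continuous γ)) hpoint
  exact fun x => (hlimit x.2).imp_left (And.imp_left Subtype.ext)

theorem isStableAction [T2Space K] (h : DetectsFixedPoints π c) :
    IsStableAction Γ (limitAction (ω : Filter I) π) :=
  isStableAction_of_isFixedPointColoring
    (fun γ => (h.continuous γ).comp continuous_subtype_val) h.isFixedPointColoring_limitAction

variable [CompactSpace K] [T2Space K] [Finite Q] [TopologicalSpace Q]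

theorem eventually_range_localPattern_eq [DiscreteTopology Q] (h : DetectsFixedPoints π c)
    (r : ℕ) {f : K → Q} (hf : Continuous f) :
    ∀ᶠ i in (ω : Filter I), Set.range (localPattern S r (f ∘ π i)) =
      Set.range (localPattern S r fun x : limitAction (ω : Filter I) π => f x) := by
  have hlim := localPattern_comp_eq_coloredPattern_comp S
    (limitAction (ω : Filter I) π).inclusion h.isFixedPointColoring_limitAction r f
  filter_upwards [eventually_range_comp_eq_image_limitSet ω (fun i => π i)
    (isLocallyConstant_coloredPattern S r h.continuous hf)] with i hi
  rw [localPattern_comp_eq_coloredPattern_comp S (π i) (h.isFixedPointColoring · i), hi]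
  refine .trans ?_ (congrArg Set.range hlim).symm
  rw [Set.range_comp]
  exact congrArg _ Subtype.range_coe.symm

theorem eventually_exists_conf_eq [TotallyDisconnectedSpace K] [DiscreteTopology Q] [Nonempty Q]
    (h : DetectsFixedPoints π c) (r : ℕ) {ψ : limitAction (ω : Filter I) π → Q}
    (hψ : Continuous ψ) :
    ∀ᶠ i in (ω : Filter I), ∃ φ : V i → Q, Conf S r φ = Conf S r ψ := by
  obtain ⟨f, hf, -, rfl⟩ := Profinite.exists_lift_of_finite_of_injective_of_surjective
    (Subtype.val : limitAction (ω : Filter I) π → K) continuous_subtype_val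
    Subtype.val_injective (fun _ : Q => ()) (fun _ => ⟨Classical.arbitrary Q, rfl⟩) ψ hψ
    (fun _ => ()) continuous_const rfl
  exact (h.eventually_range_localPattern_eq r hf).mono fun i hi =>
    ⟨f ∘ π i, conf_eq_of_range_localPattern_eq hi⟩

theorem exists_continuous_conf_eq [Nonempty Q] (h : DetectsFixedPoints π c)
    (hπ : RealizesPatterns S π) (r : ℕ) {A : Set (BallClass S r Q)}
    (hA : ∀ᶠ i in (ω : Filter I), ∃ φ : V i → Q, Conf S r φ = A) :
    ∃ ψ : limitAction (ω : Filter I) π → Q, Continuous ψ ∧ Conf S r ψ = A := by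
  obtain ⟨k, hk⟩ := Nat.exists_eq_succ_of_ne_zero (Nat.card_pos (α := Q)).ne'
  let e : Q ≃ Fin (k + 1) := Finite.equivFinOfCardEq hk
  obtain ⟨T, hT⟩ : ∃ T, ∀ᶠ i in (ω : Filter I), ∃ φ : V i → Q,
      Conf S r φ = A ∧ Set.range (localPattern S r (e ∘ φ)) = T :=
    Ultrafilter.eventually_exists_iff.1 (hA.mono fun i ⟨φ, hφ⟩ => ⟨_, φ, hφ, rfl⟩)
  obtain ⟨f, hf, hfT⟩ := hπ r k T
  obtain ⟨i, ⟨φ, rfl, hφ⟩, hi⟩ := (hT.and (h.eventually_range_localPattern_eq r hf)).exists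
  refine ⟨e.symm ∘ fun x => f x, by fun_prop, ?_⟩
  have hfφ := hi.symm.trans ((hfT i ⟨_, hφ⟩).trans hφ.symm)
  simpa [← Function.comp_assoc] using conf_comp_eq_of_range_localPattern_eq e.symm hfφ

theorem exists_continuous_conf_eq_iff [TotallyDisconnectedSpace K] [DiscreteTopology Q]
    (h : DetectsFixedPoints π c) (hπ : RealizesPatterns S π) (r : ℕ) (A : Set (BallClass S r Q)) :
    (∃ ψ : limitAction (ω : Filter I) π → Q, Continuous ψ ∧ Conf S r ψ = A) ↔
      ∀ᶠ i in (ω : Filter I), ∃ φ : V i → Q, Conf S r φ = A := by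
  cases isEmpty_or_nonempty Q
  · have hempty : ∀ᶠ i in (ω : Filter I),
        (IsEmpty (V i) ↔ IsEmpty (limitAction (ω : Filter I) π)) :=
      (eventually_isEmpty_iff_limitSet_eq_empty ω fun i => π i).mono fun i hi =>
        hi.trans Set.isEmpty_coe_sort.symm
    have hiff : ∀ᶠ i in (ω : Filter I), (∃ φ : V i → Q, Conf S r φ = A) ↔
        ∃ ψ : limitAction (ω : Filter I) π → Q, Continuous ψ ∧ Conf S r ψ = A := by
      filter_upwards [hempty] with i hi
      have hcont (ψ : limitAction (ω : Filter I) π → Q) : Continuous ψ :=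
        have := Function.isEmpty ψ
        continuous_of_discreteTopology
      simp only [hcont, true_and, exists_conf_eq_iff_of_isEmpty, hi]
    rw [eventually_congr hiff, eventually_const]
  · refine ⟨?_, h.exists_continuous_conf_eq hπ r⟩
    rintro ⟨ψ, hψ, rfl⟩
    exact h.eventually_exists_conf_eq r hψ

end DetectsFixedPoints

end LimitActions

section Cardinality

theorem mk_le_continuum_of_secondCountableTopology (X : Type*) [TopologicalSpace X] [T0Space X]
    [SecondCountableTopology X] : Cardinal.mk X ≤ Cardinal.continuum := by
  borelize X
  obtain ⟨f, -, hf⟩ := MeasurableSpace.measurable_injection_nat_bool_of_countablySeparated X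
  simpa using Cardinal.lift_mk_le_lift_mk_of_injective hf

theorem exists_ultrafilter_le_tendsto_top {I : Type*} (l : Filter I) [l.NeBot] (u : I → ℕ∞) :
    ∃ ω : Ultrafilter I, ω ≤ l ∧
      ((∀ k : ℕ, ∃ᶠ i in l, (k : ℕ∞) ≤ u i) → Tendsto u ω (𝓝 ⊤)) := by
  by_cases h : ∀ k : ℕ, ∃ᶠ i in l, (k : ℕ∞) ≤ u i
  · have hcluster : MapClusterPt ⊤ l u :=
      nhds_top_basis.mapClusterPt_iff_frequently.2 fun a ha => by
        lift a to ℕ using ha.ne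
        refine (h (a + 1)).mono fun i hi => ?_
        exact (Nat.cast_lt.2 a.lt_succ_self).trans_le hi
    obtain ⟨ω, hω, hu⟩ := mapClusterPt_iff_ultrafilter.1 hcluster
    exact ⟨ω, hω, fun _ => hu⟩
  · exact ⟨Ultrafilter.of l, Ultrafilter.of_le l, fun h' => absurd h' h⟩

theorem exists_forall_lt_card_mem_range (V : Type*) :
    ∃ e : V → ℕ, ∀ j : ℕ, (j : ℕ∞) < ENat.card V → j ∈ Set.range e := by
  rcases finite_or_infinite V with _ | _
  · refine ⟨fun v => Finite.equivFin V v, fun j hj => ?_⟩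
    rw [ENat.card_eq_coe_natCard, Nat.cast_lt] at hj
    exact ⟨(Finite.equivFin V).symm ⟨j, hj⟩, by simp⟩
  · have hinj := (Infinite.natEmbedding V).injective
    exact ⟨Function.invFun (Infinite.natEmbedding V), fun j _ =>
      ⟨_, Function.leftInverse_invFun hinj j⟩⟩

theorem limitSet_eq_univ_of_denseSeq_mem_range {I : Type*} {V : I → Type*} {Y : Type*}
    [TopologicalSpace Y] [TopologicalSpace.SeparableSpace Y] [Nonempty Y] {ω : Filter I} [ω.NeBot]
    {ρ : ∀ i, V i → Y}
    (hρ : ∀ i (j : ℕ), (j : ℕ∞) < ENat.card (V i) →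
      TopologicalSpace.denseSeq Y j ∈ Set.range (ρ i))
    (hV : Tendsto (fun i => ENat.card (V i)) ω (𝓝 ⊤)) : limitSet ω ρ = Set.univ := by
  refine Set.eq_univ_of_forall fun y => mem_limitSet_iff.2 fun U hU => ?_
  obtain ⟨_, hjU, j, rfl⟩ :=
    mem_closure_iff_nhds.1 (TopologicalSpace.denseRange_denseSeq Y y) U hU
  refine ((ENat.tendsto_nhds_top_iff_natCast_lt.1 hV j).mono fun i hi => ?_).frequently
  obtain ⟨v, hv⟩ := hρ i j hi
  exact ⟨v, hv ▸ hjU⟩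

theorem mk_limitSet_eq_continuum {I : Type*} {V : I → Type*} {K : Type*} [TopologicalSpace K]
    [CompactSpace K] [T0Space K] [SecondCountableTopology K] {ω : Filter I} [ω.NeBot]
    {π : ∀ i, V i → K} {g : K → ℕ → Bool} (hg : Continuous g)
    (hdense : ∀ i (j : ℕ), (j : ℕ∞) < ENat.card (V i) →
      TopologicalSpace.denseSeq (ℕ → Bool) j ∈ Set.range (g ∘ π i))
    (hV : Tendsto (fun i => ENat.card (V i)) ω (𝓝 ⊤)) :
    Cardinal.mk (limitSet ω π) = Cardinal.continuum := by
  refine (mk_le_continuum_of_secondCountableTopology _).antisymm ?_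
  have himage : g '' limitSet ω π = Set.univ :=
    (image_limitSet ω π hg).trans (limitSet_eq_univ_of_denseSeq_mem_range hdense hV)
  simpa [himage] using Cardinal.mk_image_le_lift (f := g) (s := limitSet ω π)

end Cardinality

section Shift

variable {Γ : Type u} [Group Γ]

attribute [local instance] arrowAction

instance {L : Type*} [TopologicalSpace L] : ContinuousConstSMul Γ (Γ → L) where
  continuous_const_smul g := continuous_pi fun γ => continuous_apply (g⁻¹ * γ)

/-- The equivariant map to the shift that extends the labelling `l`, which is recovered as the
coordinate at the identity. -/
def toShift {V L : Type*} [MulAction Γ V] (l : V → L) : V →[Γ] (Γ → L) where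
  toFun v γ := l (γ⁻¹ • v)
  map_smul' g v := funext fun γ => by
    change l (γ⁻¹ • g • v) = l ((g⁻¹ * γ)⁻¹ • v)
    rw [mul_inv_rev, inv_inv, mul_smul]

theorem eval_one_comp_toShift {V L : Type*} [MulAction Γ V] (l : V → L) :
    (fun z : Γ → L => z 1) ∘ toShift l = l := by
  funext v
  change l ((1 : Γ)⁻¹ • v) = l v
  rw [inv_one, one_smul]

variable {I : Type*} {V : I → Type u} [∀ i, MulAction Γ (V i)] {L : Type u} [TopologicalSpace L]
  {l : ∀ i, V i → L}

theorem detectsFixedPoints_toShift {c : Γ → L → Fin 4} (hc : ∀ γ, Continuous (c γ))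
    (h : ∀ (γ : Γ) i, IsFixedPointColoring (fun v : V i => γ • v) (c γ ∘ l i)) :
    DetectsFixedPoints (fun i => toShift (l i)) fun γ z => c γ (z 1) where
  continuous γ := (hc γ).comp (continuous_apply 1)
  isFixedPointColoring γ i := by
    have := h γ i
    rwa [← eval_one_comp_toShift (Γ := Γ) (l i)] at this

theorem realizesPatterns_toShift {S : Finset Γ}
    (h : ∀ (r k : ℕ) (T : Set (LocalPattern S r (Fin (k + 1)))), ∃ f : L → Fin (k + 1),
      Continuous f ∧ ∀ i, (∃ φ : V i → Fin (k + 1), Set.range (localPattern S r φ) = T) →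
        Set.range (localPattern S r (f ∘ l i)) = T) :
    RealizesPatterns S fun i => toShift (Γ := Γ) (l i) := by
  intro r k T
  obtain ⟨f, hf, hfT⟩ := h r k T
  refine ⟨fun z => f (z 1), hf.comp (continuous_apply 1), fun i hi => ?_⟩
  have := hfT i hi
  rwa [← eval_one_comp_toShift (Γ := Γ) (l i)] at this

end Shift

section UniversalLabels

variable {Γ : Type u} [Group Γ] (S : Finset Γ)

/-- The sets of local patterns of labellings by the sets `Fin (k + 1)`. Up to relabelling these are
all the sets of local patterns of labellings by nonempty finite sets. -/
abbrev PatternSet : Type u :=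
  Σ p : ℕ × ℕ, Set (LocalPattern S p.1 (Fin (p.2 + 1)))

/-- The space of labels: a colour for each group element, a value for each pattern set, and a
point of the Cantor space. -/
abbrev UniversalLabel : Type u :=
  (Γ → Fin 4) × (∀ T : PatternSet S, Fin (T.1.2 + 1)) × (ℕ → Bool)

theorem exists_universalLabel (W : Type u) [MulAction Γ W] :
    ∃ l : W → UniversalLabel S,
      (∀ γ : Γ, IsFixedPointColoring (fun w : W => γ • w) fun w => (l w).1 γ) ∧
      (∀ T : PatternSet S,
        (∃ φ : W → Fin (T.1.2 + 1), Set.range (localPattern S T.1.1 φ) = T.2) →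
          Set.range (localPattern S T.1.1 fun w => (l w).2.1 T) = T.2) ∧
      ∀ j : ℕ, (j : ℕ∞) < ENat.card W →
        TopologicalSpace.denseSeq (ℕ → Bool) j ∈ Set.range fun w => (l w).2.2 := by
  choose c hc using fun γ : Γ => exists_isFixedPointColoring (MulAction.toPerm γ : Equiv.Perm W)
  obtain ⟨e, he⟩ := exists_forall_lt_card_mem_range W
  let f (T : PatternSet S) : W → Fin (T.1.2 + 1) :=
    Classical.epsilon fun φ => Set.range (localPattern S T.1.1 φ) = T.2
  refine ⟨fun w => (fun γ => c γ w, fun T => f T w, TopologicalSpace.denseSeq _ (e w)), hc,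
    fun T => Classical.epsilon_spec, fun j hj => ?_⟩
  obtain ⟨w, rfl⟩ := he j hj
  exact ⟨w, rfl⟩

attribute [local instance] arrowAction in
theorem exists_detectsFixedPoints_realizesPatterns [Countable Γ] {I : Type*} (V : I → Type u)
    [∀ i, MulAction Γ (V i)] :
    ∃ (K : Type u) (_ : TopologicalSpace K) (_ : CompactSpace K) (_ : T2Space K)
      (_ : TotallyDisconnectedSpace K) (_ : SecondCountableTopology K) (_ : MulAction Γ K)
      (_ : ContinuousConstSMul Γ K) (π : ∀ i, V i →[Γ] K) (c : Γ → K → Fin 4)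
      (g : K → ℕ → Bool),
      DetectsFixedPoints π c ∧ RealizesPatterns S π ∧ Continuous g ∧
        ∀ i (j : ℕ), (j : ℕ∞) < ENat.card (V i) →
          TopologicalSpace.denseSeq (ℕ → Bool) j ∈ Set.range (g ∘ π i) := by
  choose l hcolor hpattern hdense using fun i => exists_universalLabel S (V i)
  refine ⟨Γ → UniversalLabel S, inferInstance, inferInstance, inferInstance, inferInstance,
    inferInstance, inferInstance, inferInstance, fun i => toShift (l i), fun γ z => (z 1).1 γ,
    fun z => (z 1).2.2, ?_, ?_, by fun_prop, fun i j hj => ?_⟩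
  · exact detectsFixedPoints_toShift (c := fun γ (x : UniversalLabel S) => x.1 γ) (by fun_prop)
      fun γ i => hcolor i γ
  · exact realizesPatterns_toShift fun r k T =>
      ⟨fun x => x.2.1 ⟨(r, k), T⟩, by fun_prop, fun i => hpattern i ⟨(r, k), T⟩⟩
  · obtain ⟨v, hv⟩ := hdense i j hj
    exact ⟨v, (congrArg (·.2.2) (congrFun (eval_one_comp_toShift (Γ := Γ) (l i)) v)).trans hv⟩

theorem exists_isStableAction_of_ultrafilter [Countable Γ] {I : Type*} (ω : Ultrafilter I)
    (V : I → Type u) [∀ i, MulAction Γ (V i)] :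
    ∃ (X : Type u) (_ : MetricSpace X) (_ : CompactSpace X) (_ : TotallyDisconnectedSpace X)
      (_ : MulAction Γ X),
      IsStableAction Γ X ∧
        (∀ (Q : Type) [Finite Q] [TopologicalSpace Q] [DiscreteTopology Q] (r : ℕ)
          (A : Set (BallClass S r Q)), (∃ ψ : X → Q, Continuous ψ ∧ Conf S r ψ = A) ↔
            ∀ᶠ i in (ω : Filter I), ∃ φ : V i → Q, Conf S r φ = A) ∧
        (Tendsto (fun i => ENat.card (V i)) ω (𝓝 ⊤) → Cardinal.mk X = Cardinal.continuum) := by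
  obtain ⟨K, _, _, _, _, _, _, _, π, c, g, hdetects, hrealizes, hg, hdense⟩ :=
    exists_detectsFixedPoints_realizesPatterns S V
  exact ⟨limitAction (ω : Filter I) π, TopologicalSpace.metrizableSpaceMetric _, inferInstance,
    inferInstance, inferInstance, hdetects.isStableAction,
    fun Q _ _ _ => hdetects.exists_continuous_conf_eq_iff hrealizes,
    mk_limitSet_eq_continuum hg hdense⟩

end UniversalLabels

theorem mainTheorem4_general {Γ : Type u} [Group Γ] [Countable Γ] (S : Finset Γ) {I : Type*}
    (l : Filter I) [l.NeBot] (V : I → Type u) [∀ i, MulAction Γ (V i)]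
    (hV : ∀ (Q : Type) [Finite Q] (r : ℕ), 1 ≤ r → ∀ A : Set (BallClass S r Q),
      (∀ᶠ i in l, ∃ φ : V i → Q, Conf S r φ = A) ∨
        (∀ᶠ i in l, ¬ ∃ φ : V i → Q, Conf S r φ = A)) :
    ∃ (X : Type u) (_ : MetricSpace X) (_ : CompactSpace X) (_ : TotallyDisconnectedSpace X)
      (_ : MulAction Γ X),
      IsStableAction Γ X ∧
        (∀ (Q : Type) [Finite Q] [TopologicalSpace Q] [DiscreteTopology Q] (r : ℕ), 1 ≤ r →
          ∀ A : Set (BallClass S r Q), (∃ ψ : X → Q, Continuous ψ ∧ Conf S r ψ = A) ↔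
            ∀ᶠ i in l, ∃ φ : V i → Q, Conf S r φ = A) ∧
        ((∀ k : ℕ, ∃ᶠ i in l, (k : ℕ∞) ≤ ENat.card (V i)) →
          Cardinal.mk X = Cardinal.continuum) := by
  obtain ⟨ω, hω, hcard⟩ := exists_ultrafilter_le_tendsto_top l fun i => ENat.card (V i)
  obtain ⟨X, hmetric, hcompact, hdisc, haction, hstable, hconf, hX⟩ :=
    exists_isStableAction_of_ultrafilter S ω V
  refine ⟨X, hmetric, hcompact, hdisc, haction, hstable, fun Q _ _ _ r hr A => ?_, hX ∘ hcard⟩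
  rw [hconf]
  refine ⟨fun hA => (hV Q r hr A).resolve_right fun hnot => ?_, fun hA => hω hA⟩
  exact Ultrafilter.eventually_not.1 (hω hnot) hA

theorem countable_of_closure_eq_top {G : Type*} [Group G] {s : Set G} [Countable s]
    (h : Subgroup.closure s = ⊤) : Countable G :=
  have hsurj : Function.Surjective (FreeGroup.lift ((↑) : s → G)) :=
    FreeGroup.lift_surjective_iff_closure_range_eq_top.2 (by rwa [Subtype.range_coe])
  hsurj.countable

theorem mainTheorem4 {Γ : Type u} [Group Γ] (S : Finset Γ)
    (hgen : Subgroup.closure (S : Set Γ) = ⊤) (hsymm : ∀ σ ∈ S, σ⁻¹ ∈ S)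
    (G : ℕ → GeneralizedSchreierGraph Γ) (hG : QualitativelyConvergent S G) :
    ∃ (X : Type u) (_ : MetricSpace X) (_ : CompactSpace X) (_ : TotallyDisconnectedSpace X)
      (_ : MulAction Γ X),
      IsStableAction Γ X ∧ QualitativelyConvergesTo S G X ∧
        ((∀ k : ℕ, ∃ᶠ n in atTop, (k : ℕ∞) ≤ ENat.card (G n).Vert) →
          Cardinal.mk X = Cardinal.continuum) := by
  have : Countable Γ := countable_of_closure_eq_top hgen
  exact mainTheorem4_general S atTop (fun n => (G n).Vert) hG
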